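/- Consider the $K$-armed bandit game over $T$ rounds against a fixed (oblivious) loss sequence $\ell_{1:T}=(\ell_{i,t})_{1\le i\le K,\,1\le t\le T}\in[0,1]^{KT}$. A randomised bandit algorithm may use an internal random seed drawn in advance; in each round $t$ it chooses a probability distribution on $\{1,\dots,K\}$ that depends measurably on the seed and on the history $(I_s,\ell_{I_s,s})_{s<t}$ of its own past actions and observed losses, and it draws its action $I_t$ from that distribution. Its regret is $$R_T(\ell_{1:T})=\sum_{t=1}^T \ell_{I_t,t}-\min_{1\le i\le K}\sum_{t=1}^T \ell_{i,t}.$$ Let $K\ge 2$, $\delta\in(0,1/4)$ and $T\ge 32(K-1)\log(2/\delta)$. Then for every randomised bandit algorithm there exists a loss sequence $\ell_{1:T}\in[0,1]^{KT}$ such that $$\mathbb{P}\left(R_T(\ell_{1:T})\ge \frac{1}{27}\sqrt{(K-1)T\log\frac{1}{4\delta}}\right)\ge \frac{\delta}{2},$$ where the probability is with respect to the randomness of the algorithm. Furthermore, $\ell_{1:T}$ can be chosen such that, in addition, there is an arm $i$ with $\ell_{i,t}=\min_j \ell_{j,t}$ for all $t\in\{1,\dots,T\}$, and for all $t\in\{1,\dots,T\}$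 $$\max_{j,k}\{\ell_{j,t}-\ell_{k,t}\}\le \frac{1}{4\sqrt{\log 2}}\sqrt{\frac{(K-1)\log(1/(4\delta))}{T}}.$$ -/

import Mathlib

open MeasureTheory ProbabilityTheory

noncomputable section

/-- The regret `∑ₜ ℓ_{Iₜ,t} - minᵢ ∑ₜ ℓ_{i,t}` of the action sequence `I` on the loss sequence `ℓ`
(`ℓ t i` is the loss of arm `i` in round `t`). -/
def regret {K T : ℕ} (ℓ : Fin T → Fin K → ℝ) (I : Fin T → Fin K) : ℝ :=
  ∑ t, ℓ t (I t) - ⨅ i, ∑ t, ℓ t i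

/-- The bandit history `(I_s, ℓ_{I_s,s})_{s<t}` available at the beginning of round `t`: the learner
has seen her own actions and the losses of the chosen arms only. -/
def banditHistory {K T : ℕ} (ℓ : Fin T → Fin K → ℝ) (I : Fin T → Fin K) (t : Fin T) :
    Fin t → Fin K × ℝ :=
  fun s => (I (s.castLE t.isLt.le), ℓ (s.castLE t.isLt.le) (I (s.castLE t.isLt.le)))

/-- A randomised `K`-armed bandit algorithm: a random seed drawn once from a probability measure
`seedLaw` on `Ω`, and for each round `t` a distribution `policy t (ω, h)` on the arms that depends
measurably on the seed `ω` and on the history `h` of the first `t` rounds.  A seedless algorithm has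
a one-point `Ω`; an algorithm that is a function of its seed and of the history has Dirac
policies. -/
structure BanditAlgorithm (K : ℕ) (Ω : Type*) [MeasurableSpace Ω] where
  seedLaw : Measure Ω
  isProbabilityMeasure_seedLaw : IsProbabilityMeasure seedLaw
  policy : (t : ℕ) → Kernel (Ω × (Fin t → Fin K × ℝ)) (Fin K)
  isMarkovKernel_policy : ∀ t, IsMarkovKernel (policy t)

/-- The law of the actions `(I_1, …, I_T)` when the algorithm faces the fixed losses `ℓ`: the seed is
drawn from `seedLaw`, then each action from the current policy given the seed and the bandit
history, so a sequence `I` has probability `∫ ∏ₜ policyₜ(ω, h_t)(I_t) d seedLaw(ω)`. -/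
def BanditAlgorithm.actionLaw {K : ℕ} {Ω : Type*} [MeasurableSpace Ω] (alg : BanditAlgorithm K Ω)
    {T : ℕ} (ℓ : Fin T → Fin K → ℝ) : Measure (Fin T → Fin K) :=
  ∑ I : Fin T → Fin K,
    (∫⁻ ω, ∏ t : Fin T, alg.policy t (ω, banditHistory ℓ I t) {I t} ∂alg.seedLaw) •
      Measure.dirac I

end

/-!
In round `t`, arm `j` has loss `1 / 2 + z t - s j`, clipped to `[0, 1]`, where the Gaussian noise
`z t` is common to all arms and `s j` is the advantage of the arm. Common noise makes the best arm
the same in every round and the loss range small.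

Start from advantages `s = Pi.single a Δ`. Some arm `i ≠ a` is played at most `T / (K - 1)` times in
expectation, and raising its advantage by `2 * Δ` makes it the best one. Lowering the noise by the
extra advantage of the arm played turns the losses observed in the second game into those of the
first, so the two games differ by a change of Gaussian measure whose divergence is
`(2 * Δ) ^ 2 / (2 * v)` times the expected number of plays of `i`. By the Bretagnolle–Huber
inequality, in one of the two games the suboptimal arms are played in at least half of the rounds
with probability at least `δ`. By Hoeffding's inequality at most a quarter of the rounds is clipped,
except with probability `δ / 2`, and every other suboptimal play costs `Δ`. Hence some realisation
of the noise gives regret at least `Δ * T / 4` with probability at least `δ / 2`.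
-/

open Set InformationTheory
open scoped Finset NNReal ENNReal

section GaussianTranslation

theorem gaussianReal_eq_withDensity_gaussianReal_zero (a : ℝ) {v : ℝ≥0} (hv : v ≠ 0) :
    gaussianReal a v = (gaussianReal 0 v).withDensity
      fun x ↦ ENNReal.ofReal (Real.exp ((2 * a * x - a ^ 2) / (2 * v))) := by
  rw [gaussianReal_of_var_ne_zero a hv, gaussianReal_of_var_ne_zero 0 hv,
    ← withDensity_mul _ (measurable_gaussianPDF 0 v) (by fun_prop)]
  congr 1
  ext x
  rw [Pi.mul_apply, gaussianPDF, gaussianPDF, gaussianPDFReal, gaussianPDFReal,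
    ← ENNReal.ofReal_mul (by positivity), mul_assoc _ (Real.exp _) (Real.exp _), ← Real.exp_add]
  congr 3
  field_simp
  ring

theorem pi_withDensity_eq_withDensity_prod {ι : Type*} [Fintype ι] {α : ι → Type*}
    [∀ i, MeasurableSpace (α i)] (μ : ∀ i, Measure (α i)) [∀ i, IsProbabilityMeasure (μ i)]
    {f : ∀ i, α i → ℝ≥0∞} (hf : ∀ i, Measurable (f i))
    [∀ i, SigmaFinite ((μ i).withDensity (f i))] :
    Measure.pi (fun i ↦ (μ i).withDensity (f i)) =
      (Measure.pi μ).withDensity fun x ↦ ∏ i, f i (x i) := by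
  refine Measure.pi_eq fun s hs ↦ ?_
  have hfs (i : ι) : Measurable ((s i).indicator (f i)) := (hf i).indicator (hs i)
  have hprod (x : ∀ i, α i) : (univ.pi s).indicator (fun x ↦ ∏ i, f i (x i)) x =
      ∏ i, (s i).indicator (f i) (x i) := by
    by_cases hx : x ∈ univ.pi s
    · rw [indicator_of_mem hx]
      exact Finset.prod_congr rfl fun i _ ↦ (indicator_of_mem (hx i (mem_univ i)) _).symm
    · obtain ⟨i, hi⟩ : ∃ i, x i ∉ s i := by simpa [mem_univ_pi] using hx
      rw [indicator_of_notMem hx,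
        Finset.prod_eq_zero (Finset.mem_univ i) (indicator_of_notMem hi _)]
  rw [withDensity_apply _ (.univ_pi hs), ← lintegral_indicator (.univ_pi hs)]
  simp_rw [hprod]
  rw [lintegral_prod_eq_prod_lintegral_of_indepFun _ _ (iIndepFun_pi fun i ↦ (hfs i).aemeasurable)
    fun i ↦ (hfs i).comp (measurable_pi_apply i)]
  refine Finset.prod_congr rfl fun i _ ↦ ?_
  rw [withDensity_apply _ (hs i), ← lintegral_indicator (hs i)]
  exact (measurePreserving_eval μ i).lintegral_comp (hfs i)

theorem lintegral_pi_gaussianReal_zero_add {ι : Type*} [Fintype ι] {v : ι → ℝ≥0}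
    (hv : ∀ i, v i ≠ 0) (a : ι → ℝ) {F : (ι → ℝ) → ℝ≥0∞} (hF : Measurable F) :
    ∫⁻ z, F (z + a) ∂Measure.pi (fun i ↦ gaussianReal 0 (v i)) =
      ∫⁻ z, ENNReal.ofReal (Real.exp (∑ i, (2 * a i * z i - a i ^ 2) / (2 * v i))) * F z
        ∂Measure.pi (fun i ↦ gaussianReal 0 (v i)) := by
  have hmap : (Measure.pi fun i ↦ gaussianReal 0 (v i)).map (· + a) =
      Measure.pi fun i ↦ gaussianReal (a i) (v i) :=
    (Measure.pi_map_pi (f := fun i x ↦ x + a i) fun i ↦ by fun_prop).trans <| by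
      simp only [gaussianReal_map_add_const, zero_add]
  have htilt (i : ι) := gaussianReal_eq_withDensity_gaussianReal_zero (a i) (hv i)
  have (i : ι) : SigmaFinite ((gaussianReal 0 (v i)).withDensity
      fun x ↦ ENNReal.ofReal (Real.exp ((2 * a i * x - a i ^ 2) / (2 * v i)))) := by
    rw [← htilt]; infer_instance
  rw [← lintegral_map hF (by fun_prop), hmap]
  simp_rw [htilt]
  rw [pi_withDensity_eq_withDensity_prod _ fun i ↦ by fun_prop,
    lintegral_withDensity_eq_lintegral_mul _ (by fun_prop) hF]
  simp only [Real.exp_sum, ENNReal.ofReal_prod_of_nonneg fun _ _ ↦ (Real.exp_pos _).le,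
    Pi.mul_apply]

end GaussianTranslation

section GaussianTail

variable {a : ℝ}

theorem gaussianReal_zero_Ioi_le (ha : 0 ≤ a) {v : ℝ≥0} (hv : v ≠ 0) :
    gaussianReal 0 v (Ioi a) ≤
      ENNReal.ofReal (Real.exp (-a ^ 2 / (2 * v))) * gaussianReal 0 v (Ioi 0) := by
  have hpre : (fun x ↦ x + -a) ⁻¹' Ioi 0 = Ioi a := by ext; simp
  calc gaussianReal 0 v (Ioi a) = gaussianReal (-a) v (Ioi 0) := by
        rw [← hpre, ← Measure.map_apply (by fun_prop) measurableSet_Ioi,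
          gaussianReal_map_add_const, zero_add]
    _ = ∫⁻ x in Ioi 0, ENNReal.ofReal (Real.exp ((2 * -a * x - (-a) ^ 2) / (2 * v)))
        ∂gaussianReal 0 v := by
        rw [gaussianReal_eq_withDensity_gaussianReal_zero _ hv,
          withDensity_apply _ measurableSet_Ioi]
    _ ≤ ∫⁻ _ in Ioi 0, ENNReal.ofReal (Real.exp (-a ^ 2 / (2 * v))) ∂gaussianReal 0 v := by
        refine setLIntegral_mono measurable_const fun x hx ↦ ?_
        gcongr
        linarith [mul_nonneg ha (mem_Ioi.1 hx).le, neg_sq a]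
    _ = _ := setLIntegral_const _ _

theorem gaussianReal_zero_setOf_lt_abs (ha : 0 ≤ a) (v : ℝ≥0) :
    gaussianReal 0 v {x | a < |x|} = 2 * gaussianReal 0 v (Ioi a) := by
  have hunion : {x | a < |x|} = Ioi a ∪ (fun x ↦ -x) ⁻¹' Ioi a := by
    ext x
    exact lt_abs (a := a) (b := x)
  have hdisj : Disjoint (Ioi a) ((fun x ↦ -x) ⁻¹' Ioi a) :=
    disjoint_left.2 fun x hx hx' ↦ by
      simp only [mem_preimage, mem_Ioi] at hx hx'
      linarith
  rw [hunion, measure_union hdisj (measurableSet_Ioi.preimage measurable_neg),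
    ← Measure.map_apply measurable_neg measurableSet_Ioi, gaussianReal_map_neg, neg_zero, two_mul]

-- Comparing with `P(x > 0) ≤ 1 / 2` on each side saves the factor `2` that Chernoff's bound and a
-- union bound would lose, and which the constants below cannot absorb.
theorem gaussianReal_zero_real_setOf_lt_abs_le (ha : 0 ≤ a) {v : ℝ≥0} (hv : v ≠ 0) :
    (gaussianReal 0 v).real {x | a < |x|} ≤ Real.exp (-a ^ 2 / (2 * v)) := by
  refine ENNReal.toReal_le_of_le_ofReal (Real.exp_pos _).le ?_
  calc gaussianReal 0 v {x | a < |x|}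
      ≤ 2 * (ENNReal.ofReal (Real.exp (-a ^ 2 / (2 * v))) * gaussianReal 0 v (Ioi 0)) := by
        rw [gaussianReal_zero_setOf_lt_abs ha]
        gcongr
        exact gaussianReal_zero_Ioi_le ha hv
    _ = ENNReal.ofReal (Real.exp (-a ^ 2 / (2 * v))) * gaussianReal 0 v {x | 0 < |x|} := by
        rw [gaussianReal_zero_setOf_lt_abs le_rfl, mul_left_comm]
    _ ≤ _ := mul_le_of_le_one_right' prob_le_one

end GaussianTail

section ProductMeasure

variable {ι : Type*} [Fintype ι]

theorem measureReal_pi_le_card_filter_mem_le {α : Type*} [MeasurableSpace α] (μ : Measure α)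
    [IsProbabilityMeasure μ] {B : Set α} [DecidablePred (· ∈ B)] (hB : MeasurableSet B) {ε : ℝ}
    (hε : 0 ≤ ε) :
    (Measure.pi fun _ : ι ↦ μ).real {z | Fintype.card ι * (μ.real B + ε) ≤ #{i | z i ∈ B}} ≤
      Real.exp (-2 * Fintype.card ι * ε ^ 2) := by
  have hmeas : Measurable (B.indicator (1 : α → ℝ)) := measurable_one.indicator hB
  have hmean (i : ι) : ∫ z, B.indicator 1 (z i) ∂Measure.pi (fun _ : ι ↦ μ) = μ.real B := by
    rw [integral_comp_eval (μ := fun _ : ι ↦ μ) (f := B.indicator (1 : α → ℝ))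
      hmeas.aestronglyMeasurable, integral_indicator_one hB]
  have hindep : iIndepFun (fun i z ↦ B.indicator 1 (z i) - μ.real B)
      (Measure.pi fun _ : ι ↦ μ) :=
    iIndepFun_pi (X := fun _ x ↦ B.indicator 1 x - μ.real B)
      fun _ ↦ (hmeas.sub_const _).aemeasurable
  have hsubG (i : ι) : HasSubgaussianMGF (fun z ↦ B.indicator 1 (z i) - μ.real B)
      ((‖(1 : ℝ) - 0‖₊ / 2) ^ 2) (Measure.pi fun _ : ι ↦ μ) := by
    rw [← hmean i]
    exact hasSubgaussianMGF_of_mem_Icc (hmeas.comp (measurable_pi_apply i)).aemeasurable <|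
      .of_forall fun z ↦ ⟨indicator_nonneg (fun _ _ ↦ zero_le_one) _,
        indicator_le_self' (fun _ _ ↦ zero_le_one) _⟩
  have hset : {z : ι → α | Fintype.card ι * (μ.real B + ε) ≤ #{i | z i ∈ B}} =
      {z | Fintype.card ι * ε ≤ ∑ i, (B.indicator 1 (z i) - μ.real B)} := by
    ext z
    have hcount : (#{i | z i ∈ B} : ℝ) = ∑ i, B.indicator 1 (z i) := by
      simp only [indicator_apply, Pi.one_apply, Finset.sum_boole]
    simp only [mem_ofPred_eq, hcount, Finset.sum_sub_distrib, Finset.sum_const,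
      nsmul_eq_mul, Finset.card_univ]
    rw [mul_add, le_sub_iff_add_le']
  rw [hset]
  refine (HasSubgaussianMGF.measure_sum_ge_le_of_iIndepFun hindep (fun i _ ↦ hsubG i)
    (by positivity)).trans_eq ?_
  congr 1
  rcases eq_or_ne (Fintype.card ι : ℝ) 0 with hn | hn
  · simp [hn]
  · simp only [sub_zero, nnnorm_one, Finset.sum_const, Finset.card_univ, nsmul_eq_mul]
    push_cast
    field_simp

theorem integral_eval_mul_eq_zero_of_dependsOn {μ : ι → Measure ℝ}
    [∀ i, IsProbabilityMeasure (μ i)] {i : ι} (hμ : ∫ x, x ∂μ i = 0) {g : (ι → ℝ) → ℝ}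
    (hg : Measurable g) (hgi : DependsOn g {i}ᶜ) : ∫ z, z i * g z ∂Measure.pi μ = 0 := by
  classical
  let extend (y : ({i}ᶜ : Finset ι) → ℝ) : ι → ℝ := Function.updateFinset 0 {i}ᶜ y
  have hextend (z : ι → ℝ) : g (extend fun j ↦ z j) = g z :=
    hgi fun j hj ↦ by simp_all [extend, Function.updateFinset]
  have hindep : IndepFun (fun z ↦ z i) g (Measure.pi μ) := by
    have := (iIndepFun_pi (μ := μ) (X := fun _ x ↦ x) fun _ ↦ aemeasurable_id).indepFun_finset
      {i} {i}ᶜ disjoint_compl_right fun j ↦ measurable_pi_apply j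
    have heval : Measurable fun y : ({i} : Finset ι) → ℝ ↦ y ⟨i, Finset.mem_singleton_self i⟩ :=
      measurable_pi_apply _
    convert this.comp (ψ := g ∘ extend) heval (hg.comp measurable_updateFinset) using 1
    exacts [rfl, funext fun z ↦ (hextend z).symm]
  rw [hindep.integral_fun_mul_eq_mul_integral (measurable_pi_apply i).aestronglyMeasurable
    hg.aestronglyMeasurable, integral_comp_eval (μ := μ) (f := fun x ↦ x) aestronglyMeasurable_id,
    hμ, zero_mul]

end ProductMeasure

theorem exists_notMem_le_of_add_le_lintegral {α : Type*} [MeasurableSpace α] {μ : Measure α}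
    [IsProbabilityMeasure μ] {f : α → ℝ≥0∞} (hf : ∀ x, f x ≤ 1) {B : Set α} {ε : ℝ≥0∞}
    (hε : ε ≠ 0) (h : ε + μ B ≤ ∫⁻ x, f x ∂μ) : ∃ x ∉ B, ε ≤ f x := by
  have hle : ∫⁻ x, f x - (toMeasurable μ B).indicator 1 x ∂μ ≤ 1 := by
    refine (lintegral_mono fun x ↦ tsub_le_self.trans (hf x)).trans_eq (by simp)
  obtain ⟨x, hx⟩ := exists_lintegral_le (hle.trans_lt ENNReal.one_lt_top).ne
  have hεx : ε ≤ f x - (toMeasurable μ B).indicator 1 x := calc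
    ε ≤ ∫⁻ x, f x ∂μ - μ B := ENNReal.le_sub_of_add_le_right (measure_ne_top μ B) h
    _ = ∫⁻ x, f x ∂μ - ∫⁻ x, (toMeasurable μ B).indicator 1 x ∂μ := by
      rw [lintegral_indicator_one (measurableSet_toMeasurable μ B), measure_toMeasurable]
    _ ≤ ∫⁻ x, f x - (toMeasurable μ B).indicator 1 x ∂μ :=
      lintegral_sub_le _ _ (measurable_one.indicator (measurableSet_toMeasurable μ B))
    _ ≤ f x - (toMeasurable μ B).indicator 1 x := hx
  refine ⟨x, fun hxB ↦ hε ?_, hεx.trans tsub_le_self⟩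
  rw [indicator_of_mem (subset_toMeasurable μ B hxB), Pi.one_apply,
    tsub_eq_zero_of_le (hf x)] at hεx
  exact nonpos_iff_eq_zero.1 hεx

section BretagnolleHuber

variable {α : Type*} [MeasurableSpace α] {μ ν : Measure α}

-- The tangent of `exp` at `-κ / 2` does the work of Jensen's inequality after integration, and
-- `2 * x * y ≤ x ^ 2 + y ^ 2` that of the Cauchy–Schwarz inequality, in the usual proof of the
-- Bretagnolle–Huber bound.
theorem exp_neg_mul_sub_le_min_one_exp_neg (κ g : ℝ) :
    Real.exp (-κ) * (1 - (g - κ) / 2) - Real.exp (-κ) / 4 * (1 + Real.exp (-g)) ≤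
      min 1 (Real.exp (-g)) := by
  set s := Real.exp (-κ / 2) with hs
  set u := Real.exp (-g / 2) with hu
  have hs2 : Real.exp (-κ) = s ^ 2 := by rw [hs, ← Real.exp_nat_mul]; congr 1; ring
  have hu2 : Real.exp (-g) = u ^ 2 := by rw [hu, ← Real.exp_nat_mul]; congr 1; ring
  have htangent : s * (1 - (g - κ) / 2) ≤ u := by
    have hsplit : u = s * Real.exp (-(g - κ) / 2) := by rw [hu, hs, ← Real.exp_add]; congr 1; ring
    rw [hsplit]
    gcongr
    linarith [Real.add_one_le_exp (-(g - κ) / 2)]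
  have hmul : s ^ 2 * (1 - (g - κ) / 2) ≤ s * u := by
    rw [sq, mul_assoc]
    gcongr
  have hamgm_one : s * u ≤ 1 + s ^ 2 / 4 * u ^ 2 := by nlinarith [sq_nonneg (s * u / 2 - 1)]
  have hamgm_sq : s * u ≤ u ^ 2 + s ^ 2 / 4 := by nlinarith [sq_nonneg (s / 2 - u)]
  rw [hs2, hu2]
  exact le_min (by linarith [sq_nonneg s]) (by linarith [mul_nonneg (sq_nonneg s) (sq_nonneg u)])

theorem exp_neg_integral_le_integral_min_one_exp_neg [IsProbabilityMeasure μ] {g : α → ℝ}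
    (hg : Integrable g μ) (hexp : Integrable (fun x ↦ Real.exp (-g x)) μ)
    (hle : ∫ x, Real.exp (-g x) ∂μ ≤ 1) :
    Real.exp (-∫ x, g x ∂μ) / 2 ≤ ∫ x, min 1 (Real.exp (-g x)) ∂μ := by
  set κ := ∫ x, g x ∂μ with hκ
  have hcentred : ∫ x, (1 - (g x - κ) / 2) ∂μ = 1 := by
    have hsub : Integrable (fun x ↦ g x - κ) μ := hg.sub (integrable_const κ)
    rw [integral_sub (integrable_const 1) (hsub.div_const 2), integral_div,
      integral_sub hg (integrable_const κ), ← hκ]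
    simp
  have hint_tangent : Integrable (fun x ↦ Real.exp (-κ) * (1 - (g x - κ) / 2)) μ :=
    ((integrable_const 1).sub ((hg.sub (integrable_const κ)).div_const 2)).const_mul _
  have hint_one_add : Integrable (fun x ↦ Real.exp (-κ) / 4 * (1 + Real.exp (-g x))) μ :=
    ((integrable_const 1).add hexp).const_mul _
  calc Real.exp (-κ) / 2
      ≤ Real.exp (-κ) * 1 - Real.exp (-κ) / 4 * (1 + ∫ x, Real.exp (-g x) ∂μ) := by
        nlinarith [Real.exp_pos (-κ)]
    _ = ∫ x, Real.exp (-κ) * (1 - (g x - κ) / 2) -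
        Real.exp (-κ) / 4 * (1 + Real.exp (-g x)) ∂μ := by
        rw [integral_sub hint_tangent hint_one_add, integral_const_mul, hcentred,
          integral_const_mul, integral_add (integrable_const 1) hexp]
        simp
    _ ≤ ∫ x, min 1 (Real.exp (-g x)) ∂μ :=
        integral_mono (hint_tangent.sub hint_one_add) ((integrable_const 1).inf hexp) fun x ↦
          exp_neg_mul_sub_le_min_one_exp_neg κ (g x)

theorem exp_neg_toReal_klDiv_le [IsProbabilityMeasure μ] [IsProbabilityMeasure ν]
    (h : klDiv μ ν ≠ ∞) {A : Set α} (hA : MeasurableSet A) :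
    Real.exp (-(klDiv μ ν).toReal) / 2 ≤ μ.real A + ν.real Aᶜ := by
  obtain ⟨hac, hint⟩ := klDiv_ne_top_iff.1 h
  have hexp := exp_neg_llr hac
  have hint_exp : Integrable (fun x ↦ Real.exp (-llr μ ν x)) μ :=
    Measure.integrable_toReal_rnDeriv.congr hexp.symm
  have hset (B : Set α) : ∫ x in B, Real.exp (-llr μ ν x) ∂μ ≤ ν.real B := by
    rw [integral_congr_ae (ae_restrict_of_ae hexp)]
    exact Measure.setIntegral_toReal_rnDeriv_le (measure_ne_top ν B)
  have hint_min : Integrable (fun x ↦ min 1 (Real.exp (-llr μ ν x))) μ :=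
    (integrable_const 1).inf hint_exp
  calc Real.exp (-(klDiv μ ν).toReal) / 2 ≤ ∫ x, min 1 (Real.exp (-llr μ ν x)) ∂μ := by
        rw [toReal_klDiv_of_measure_eq hac (by simp)]
        exact exp_neg_integral_le_integral_min_one_exp_neg hint hint_exp (by simpa using hset univ)
    _ = ∫ x in A, min 1 (Real.exp (-llr μ ν x)) ∂μ +
        ∫ x in Aᶜ, min 1 (Real.exp (-llr μ ν x)) ∂μ := (integral_add_compl hA hint_min).symm
    _ ≤ ∫ _ in A, (1 : ℝ) ∂μ + ∫ x in Aᶜ, Real.exp (-llr μ ν x) ∂μ := by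
        gcongr ?_ + ?_
        · exact integral_mono hint_min.integrableOn (integrable_const 1) fun _ ↦ min_le_left _ _
        · exact integral_mono hint_min.integrableOn hint_exp.integrableOn fun _ ↦ min_le_right _ _
    _ ≤ μ.real A + ν.real Aᶜ := by
        gcongr
        · simp
        · exact hset Aᶜ

theorem klDiv_withDensity_exp_neg [IsProbabilityMeasure μ] {g : α → ℝ} (hg : Measurable g)
    (hint : Integrable g μ)
    [IsProbabilityMeasure (μ.withDensity fun x ↦ ENNReal.ofReal (Real.exp (-g x)))] :
    klDiv μ (μ.withDensity fun x ↦ ENNReal.ofReal (Real.exp (-g x))) =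
      ENNReal.ofReal (∫ x, g x ∂μ) := by
  have hdens : Measurable fun x ↦ ENNReal.ofReal (Real.exp (-g x)) := by fun_prop
  have hpos (x : α) : ENNReal.ofReal (Real.exp (-g x)) ≠ 0 := by simp [Real.exp_pos]
  have hllr : llr μ (μ.withDensity fun x ↦ ENNReal.ofReal (Real.exp (-g x))) =ᵐ[μ] g := by
    filter_upwards [Measure.rnDeriv_withDensity_right μ μ hdens.aemeasurable (.of_forall hpos)
      (.of_forall fun x ↦ ENNReal.ofReal_ne_top), Measure.rnDeriv_self μ] with x hx hself
    rw [llr, hx, hself, mul_one, ENNReal.toReal_inv, ENNReal.toReal_ofReal (Real.exp_pos _).le,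
      Real.log_inv, Real.log_exp, neg_neg]
  rw [klDiv_of_ac_of_integrable (withDensity_absolutelyContinuous' hdens.aemeasurable
    (.of_forall hpos)) (hint.congr hllr.symm), integral_congr_ae hllr]
  simp

end BretagnolleHuber

theorem dependsOn_banditHistory {K T : ℕ} (I : Fin T → Fin K) (t : Fin T) :
    DependsOn (fun ℓ : Fin T → Fin K → ℝ ↦ banditHistory ℓ I t) (Iio t) := by
  intro ℓ ℓ' h
  funext s
  have hs : s.castLE t.isLt.le ∈ Iio t := Fin.lt_def.2 s.isLt
  simp only [banditHistory, h _ hs]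

namespace BanditAlgorithm

variable {K T : ℕ} {Ω : Type*} [MeasurableSpace Ω] (alg : BanditAlgorithm K Ω)

instance : IsProbabilityMeasure alg.seedLaw := alg.isProbabilityMeasure_seedLaw

instance (t : ℕ) : IsMarkovKernel (alg.policy t) := alg.isMarkovKernel_policy t

/-- The conditional probability, given the seed `ω`, that the algorithm plays `I` against the losses
`ℓ`. -/
noncomputable def seedWeight (ω : Ω) (ℓ : Fin T → Fin K → ℝ) (I : Fin T → Fin K) : ℝ≥0∞ :=
  ∏ t : Fin T, alg.policy t (ω, banditHistory ℓ I t) {I t}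

theorem measurable_seedWeight (I : Fin T → Fin K) :
    Measurable fun p : (Fin T → Fin K → ℝ) × Ω ↦ alg.seedWeight p.2 p.1 I := by
  refine Finset.measurable_prod _ fun t _ ↦
    ((alg.policy t).measurable_coe (measurableSet_singleton (I t))).comp ?_
  unfold banditHistory
  fun_prop

theorem actionLaw_singleton (ℓ : Fin T → Fin K → ℝ) (I : Fin T → Fin K) :
    alg.actionLaw ℓ {I} = ∫⁻ ω, alg.seedWeight ω ℓ I ∂alg.seedLaw := by
  classical
  rw [actionLaw, Measure.finsetSum_apply]
  simp only [Measure.smul_apply, Measure.dirac_apply, indicator_apply, mem_singleton_iff,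
    Pi.one_apply, smul_eq_mul, mul_ite, mul_one, mul_zero, Finset.sum_ite_eq', Finset.mem_univ,
    if_true, seedWeight]

theorem actionLaw_singleton_congr {ℓ ℓ' : Fin T → Fin K → ℝ} {I : Fin T → Fin K}
    (h : ∀ t, ℓ t (I t) = ℓ' t (I t)) : alg.actionLaw ℓ {I} = alg.actionLaw ℓ' {I} := by
  have hhistory : banditHistory ℓ I = banditHistory ℓ' I := by
    simp only [funext_iff, banditHistory, h, implies_true]
  simp only [actionLaw_singleton, seedWeight, hhistory]

theorem sum_seedWeight_snoc (ω : Ω) (ℓ : Fin (T + 1) → Fin K → ℝ) (J : Fin T → Fin K) :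
    ∑ a, alg.seedWeight ω ℓ (Fin.snoc (α := fun _ ↦ Fin K) J a) =
      alg.seedWeight ω (Fin.init ℓ) J := by
  have hsnoc (a : Fin K) (t : Fin (T + 1)) (s : Fin t) :
      Fin.snoc (α := fun _ ↦ Fin K) J a (s.castLE t.isLt.le) =
        J (s.castLE (Nat.le_of_lt_succ t.isLt)) :=
    Fin.snoc_castSucc (α := fun _ ↦ Fin K) a J (s.castLE (Nat.le_of_lt_succ t.isLt))
  have hhistory (a : Fin K) (t : Fin (T + 1)) :
      banditHistory ℓ (Fin.snoc (α := fun _ ↦ Fin K) J a) t = fun s ↦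
        (J (s.castLE (Nat.le_of_lt_succ t.isLt)),
          ℓ (s.castLE t.isLt.le) (J (s.castLE (Nat.le_of_lt_succ t.isLt)))) :=
    funext fun s ↦ by rw [banditHistory, hsnoc]
  simp only [seedWeight, Fin.prod_univ_castSucc, Fin.snoc_castSucc, Fin.snoc_last, hhistory]
  rw [← Finset.mul_sum, sum_measure_singleton, Finset.coe_univ, measure_univ, mul_one]
  rfl

theorem map_init_actionLaw (ℓ : Fin (T + 1) → Fin K → ℝ) :
    (alg.actionLaw ℓ).map (Fin.init (α := fun _ ↦ Fin K)) = alg.actionLaw (Fin.init ℓ) := by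
  refine Measure.ext_of_singleton fun J ↦ ?_
  let snoc : Fin K ↪ (Fin (T + 1) → Fin K) :=
    ⟨Fin.snoc (α := fun _ ↦ Fin K) J, Fin.snoc_right_injective (α := fun _ ↦ Fin K) J⟩
  have hpre : Fin.init (α := fun _ ↦ Fin K) ⁻¹' {J} = (Finset.univ.map snoc : Finset _) := by
    ext I
    simp only [mem_preimage, mem_singleton_iff, Finset.coe_map, Finset.coe_univ, image_univ,
      mem_range, snoc, Function.Embedding.coeFn_mk]
    refine ⟨fun h ↦ ⟨I (Fin.last T), ?_⟩, fun ⟨a, h⟩ ↦ ?_⟩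
    · rw [← h, Fin.snoc_init_self]
    · rw [← h, Fin.init_snoc]
  rw [Measure.map_apply (measurable_of_finite _) (measurableSet_singleton J), hpre,
    ← sum_measure_singleton, Finset.sum_map]
  simp only [actionLaw_singleton]
  calc ∑ a, ∫⁻ ω, alg.seedWeight ω ℓ (snoc a) ∂alg.seedLaw
      = ∫⁻ ω, ∑ a, alg.seedWeight ω ℓ (snoc a) ∂alg.seedLaw :=
        (lintegral_finsetSum _ fun a _ ↦
          (alg.measurable_seedWeight (snoc a)).comp measurable_prodMk_left).symm
    _ = ∫⁻ ω, alg.seedWeight ω (Fin.init ℓ) J ∂alg.seedLaw :=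
        lintegral_congr fun ω ↦ alg.sum_seedWeight_snoc ω ℓ J

instance isProbabilityMeasure_actionLaw (ℓ : Fin T → Fin K → ℝ) :
    IsProbabilityMeasure (alg.actionLaw ℓ) := by
  induction T with
  | zero =>
    refine ⟨?_⟩
    rw [univ_unique, actionLaw_singleton]
    simp [seedWeight]
  | succ T ih =>
    have := ih (Fin.init ℓ)
    rw [← map_init_actionLaw] at this
    exact Measure.isProbabilityMeasure_of_map (Fin.init (α := fun _ ↦ Fin K))

theorem dependsOn_map_eval_actionLaw (t : Fin T) :
    DependsOn (fun ℓ ↦ (alg.actionLaw ℓ).map fun I ↦ I t) (Iio t) := by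
  intro ℓ ℓ' h
  induction T with
  | zero => exact t.elim0
  | succ T ih =>
    cases t using Fin.lastCases with
    | last =>
      have hhistory (I : Fin (T + 1) → Fin K) : banditHistory ℓ I = banditHistory ℓ' I := by
        funext t
        exact dependsOn_banditHistory I t fun s hs ↦ h s (hs.trans_le (Fin.le_last t))
      have hlaw : alg.actionLaw ℓ = alg.actionLaw ℓ' := by
        simp only [actionLaw, hhistory]
      simp only [hlaw]
    | cast t =>
      have hinit (ℓ : Fin (T + 1) → Fin K → ℝ) :
          (alg.actionLaw ℓ).map (fun I ↦ I t.castSucc) =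
            (alg.actionLaw (Fin.init ℓ)).map fun J ↦ J t := by
        rw [← map_init_actionLaw, Measure.map_map (measurable_of_finite _) (measurable_of_finite _)]
        rfl
      simp only [hinit]
      exact ih t fun s hs ↦ h s.castSucc (Fin.castSucc_lt_castSucc_iff.2 hs)

theorem measurable_actionLaw :
    Measurable (alg.actionLaw : (Fin T → Fin K → ℝ) → Measure (Fin T → Fin K)) := by
  refine Measure.measurable_of_measurable_coe _ fun S _ ↦ ?_
  simp only [actionLaw, Measure.finsetSum_apply, Measure.smul_apply, smul_eq_mul]
  exact Finset.measurable_sum _ fun I _ ↦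
    (alg.measurable_seedWeight I).lintegral_prod_right'.mul_const _

/-- The law of the actions as a Markov kernel from loss sequences to action sequences. -/
noncomputable def actionKernel : Kernel (Fin T → Fin K → ℝ) (Fin T → Fin K) where
  toFun := alg.actionLaw
  measurable' := alg.measurable_actionLaw

instance : IsMarkovKernel (alg.actionKernel (T := T)) :=
  ⟨alg.isProbabilityMeasure_actionLaw⟩

end BanditAlgorithm

/-- The loss of arm `j` in round `t`: the level `1 / 2` plus the noise `z t` shared by all arms,
minus the advantage `s j` of arm `j`, clipped to `[0, 1]`. -/
noncomputable def noisyLoss {K T : ℕ} (s : Fin K → ℝ) (z : Fin T → ℝ) (t : Fin T) (j : Fin K) : ℝ :=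
  projIcc (0 : ℝ) 1 zero_le_one (1 / 2 + z t - s j)

/-- The advantages `s` lie in `[0, d]`, and arm `b` is ahead of every other arm by at least `Δ`. -/
structure HasGap {K : ℕ} (s : Fin K → ℝ) (b : Fin K) (Δ d : ℝ) : Prop where
  mem_Icc : ∀ j, s j ∈ Icc 0 d
  add_le : ∀ j ≠ b, s j + Δ ≤ s b

section NoisyLoss

variable {K T : ℕ} {s : Fin K → ℝ} {z : Fin T → ℝ}

theorem noisyLoss_mem_Icc (t : Fin T) (j : Fin K) : noisyLoss s z t j ∈ Icc (0 : ℝ) 1 :=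
  (projIcc (0 : ℝ) 1 zero_le_one (1 / 2 + z t - s j)).2

theorem measurable_noisyLoss (s : Fin K → ℝ) :
    Measurable (noisyLoss s : (Fin T → ℝ) → Fin T → Fin K → ℝ) :=
  measurable_pi_lambda _ fun t ↦ measurable_pi_lambda _ fun j ↦
    (continuous_subtype_val.comp continuous_projIcc).measurable.comp <| by fun_prop

theorem noisyLoss_le_noisyLoss {i j : Fin K} (h : s j ≤ s i) (t : Fin T) :
    noisyLoss s z t i ≤ noisyLoss s z t j :=
  Subtype.coe_le_coe.2 <| monotone_projIcc _ <| sub_le_sub_left h _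

theorem noisyLoss_add (s u : Fin K → ℝ) (z : Fin T → ℝ) (t : Fin T) (j : Fin K) :
    noisyLoss (s + u) z t j = noisyLoss s (fun t ↦ z t - u j) t j := by
  rw [noisyLoss, noisyLoss, Pi.add_apply, sub_add_eq_sub_sub_swap, add_sub_assoc (1 / 2) (z t)]

theorem noisyLoss_eq_of_abs_le {d : ℝ} (hs : ∀ j, s j ∈ Icc 0 d) {t : Fin T}
    (hz : |z t| ≤ 1 / 2 - d) (j : Fin K) : noisyLoss s z t j = 1 / 2 + z t - s j := by
  obtain ⟨hz₁, hz₂⟩ := abs_le.1 hz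
  have hmem : 1 / 2 + z t - s j ∈ Icc (0 : ℝ) 1 :=
    ⟨by linarith [(hs j).2], by linarith [(hs j).1, (hs j).2]⟩
  rw [noisyLoss, projIcc_of_mem _ hmem]

theorem noisyLoss_sub_le {d : ℝ} (hs : ∀ j, s j ∈ Icc 0 d) (t : Fin T) (j k : Fin K) :
    noisyLoss s z t j - noisyLoss s z t k ≤ d :=
  calc noisyLoss s z t j - noisyLoss s z t k
      ≤ |(1 / 2 + z t - s j) - (1 / 2 + z t - s k)| :=
        (le_abs_self _).trans (abs_projIcc_sub_projIcc _)
    _ = |s k - s j| := by rw [sub_sub_sub_cancel_left]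
    _ ≤ d :=
        abs_sub_le_iff.2 ⟨by linarith [(hs j).1, (hs k).2], by linarith [(hs j).2, (hs k).1]⟩

namespace HasGap

variable {b : Fin K} {Δ d : ℝ}

theorem le (h : HasGap s b Δ d) (hΔ : 0 ≤ Δ) (j : Fin K) : s j ≤ s b := by
  obtain rfl | hj := eq_or_ne j b
  · exact le_rfl
  · linarith [h.add_le j hj]

theorem sub_le_noisyLoss_sub (h : HasGap s b Δ d) (hΔ : 0 ≤ Δ) (t : Fin T) (j : Fin K) :
    (if j ≠ b then Δ else 0) - (if 1 / 2 - d < |z t| then Δ else 0) ≤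
      noisyLoss s z t j - noisyLoss s z t b := by
  have hmono := noisyLoss_le_noisyLoss (z := z) (h.le hΔ j) t
  by_cases hz : 1 / 2 - d < |z t|
  · rw [if_pos hz]
    split_ifs <;> linarith
  · obtain rfl | hj := eq_or_ne j b
    · rw [if_neg (not_not.2 rfl), if_neg hz, sub_self, sub_self]
    · rw [if_pos hj, if_neg hz, noisyLoss_eq_of_abs_le h.mem_Icc (not_lt.1 hz),
        noisyLoss_eq_of_abs_le h.mem_Icc (not_lt.1 hz)]
      linarith [h.add_le j hj]

theorem le_regret (h : HasGap s b Δ d) (hΔ : 0 ≤ Δ) (I : Fin T → Fin K) :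
    Δ * (#{t | I t ≠ b} - #{t | 1 / 2 - d < |z t|} : ℝ) ≤ regret (noisyLoss s z) I :=
  calc Δ * (#{t | I t ≠ b} - #{t | 1 / 2 - d < |z t|} : ℝ)
      = ∑ t, ((if I t ≠ b then Δ else 0) - (if 1 / 2 - d < |z t| then Δ else 0)) := by
        rw [Finset.sum_sub_distrib, ← Finset.sum_filter, ← Finset.sum_filter, Finset.sum_const,
          Finset.sum_const, nsmul_eq_mul, nsmul_eq_mul, mul_sub, mul_comm Δ, mul_comm Δ]
    _ ≤ ∑ t, (noisyLoss s z t (I t) - noisyLoss s z t b) :=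
        Finset.sum_le_sum fun t _ ↦ h.sub_le_noisyLoss_sub hΔ t (I t)
    _ = ∑ t, noisyLoss s z t (I t) - ∑ t, noisyLoss s z t b := Finset.sum_sub_distrib ..
    _ ≤ regret (noisyLoss s z) I :=
        sub_le_sub_left (ciInf_le (finite_range fun i ↦ ∑ t, noisyLoss s z t i).bddBelow b) _

end HasGap

end NoisyLoss

/-- Independent centred Gaussian noise of variance `v` in each of `T` rounds. -/
noncomputable abbrev gaussianNoise (v : ℝ≥0) (T : ℕ) : Measure (Fin T → ℝ) :=
  Measure.pi fun _ ↦ gaussianReal 0 v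

namespace BanditAlgorithm

variable {K T : ℕ} {Ω : Type*} [MeasurableSpace Ω] (alg : BanditAlgorithm K Ω) {v : ℝ≥0}

/-- The joint law of the noise and of the actions when the algorithm faces the noisy losses with
advantages `s`. -/
noncomputable def noisyGame (v : ℝ≥0) (T : ℕ) (s : Fin K → ℝ) :
    Measure ((Fin T → ℝ) × (Fin T → Fin K)) :=
  gaussianNoise v T ⊗ₘ alg.actionKernel.comap (noisyLoss s) (measurable_noisyLoss s)

instance (s : Fin K → ℝ) : IsProbabilityMeasure (alg.noisyGame v T s) := by
  unfold noisyGame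
  infer_instance

theorem measurable_actionLaw_noisyLoss (s : Fin K → ℝ) (I : Fin T → Fin K) :
    Measurable fun z ↦ alg.actionLaw (noisyLoss s z) {I} :=
  (Measure.measurable_coe (measurableSet_singleton I)).comp <|
    alg.measurable_actionLaw.comp (measurable_noisyLoss s)

theorem lintegral_noisyGame (s : Fin K → ℝ) {F : (Fin T → ℝ) × (Fin T → Fin K) → ℝ≥0∞}
    (hF : Measurable F) :
    ∫⁻ p, F p ∂alg.noisyGame v T s =
      ∑ I, ∫⁻ z, F (z, I) * alg.actionLaw (noisyLoss s z) {I} ∂gaussianNoise v T := by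
  rw [noisyGame, Measure.lintegral_compProd hF, ← lintegral_finsetSum]
  · exact lintegral_congr fun z ↦ lintegral_fintype _
  · exact fun I _ ↦ (hF.comp measurable_prodMk_right).mul (alg.measurable_actionLaw_noisyLoss s I)

theorem noisyGame_preimage_snd (s : Fin K → ℝ) (A : Set (Fin T → Fin K)) :
    alg.noisyGame v T s (Prod.snd ⁻¹' A) =
      ∫⁻ z, alg.actionLaw (noisyLoss s z) A ∂gaussianNoise v T := by
  rw [noisyGame, Measure.compProd_apply (measurable_snd A.toFinite.measurableSet)]
  rfl

/-- The log-likelihood ratio of the games with advantages `s` and `s + u`, the noise of the latter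
being recentred so that the two games share their losses. -/
noncomputable def logRatio (v : ℝ≥0) (u : Fin K → ℝ) (p : (Fin T → ℝ) × (Fin T → Fin K)) : ℝ :=
  ∑ t, (2 * (p.1 t * u (p.2 t)) + u (p.2 t) ^ 2) / (2 * v)

/-- Lowering the noise by the extra advantage `u` of the arm played. -/
def recentre (u : Fin K → ℝ) (p : (Fin T → ℝ) × (Fin T → Fin K)) :
    (Fin T → ℝ) × (Fin T → Fin K) :=
  (fun t ↦ p.1 t - u (p.2 t), p.2)

theorem measurable_recentre (u : Fin K → ℝ) : Measurable (recentre (T := T) u) := by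
  unfold recentre
  fun_prop

theorem measurable_logRatio (u : Fin K → ℝ) : Measurable (logRatio (T := T) v u) := by
  unfold logRatio
  fun_prop

theorem map_recentre_noisyGame_add (hv : v ≠ 0) (s u : Fin K → ℝ) :
    (alg.noisyGame v T (s + u)).map (recentre u) =
      (alg.noisyGame v T s).withDensity
        fun p ↦ ENNReal.ofReal (Real.exp (-logRatio v u p)) := by
  have hratio := measurable_logRatio (T := T) (v := v) u
  refine Measure.ext_of_lintegral _ fun F hF ↦ ?_
  rw [lintegral_map hF (measurable_recentre u),
    alg.lintegral_noisyGame (F := fun p ↦ F (recentre u p)) _ (hF.comp (measurable_recentre u)),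
    lintegral_withDensity_eq_lintegral_mul _ (by fun_prop) hF,
    lintegral_noisyGame _ _ (by fun_prop)]
  refine Finset.sum_congr rfl fun I _ ↦ ?_
  let Φ (z : Fin T → ℝ) : ℝ≥0∞ := F (z, I) * alg.actionLaw (noisyLoss s z) {I}
  have hΦ : Measurable Φ := (hF.comp measurable_prodMk_right).mul <|
    alg.measurable_actionLaw_noisyLoss s I
  have hshift (z : Fin T → ℝ) :
      F (recentre u (z, I)) * alg.actionLaw (noisyLoss (s + u) z) {I} =
        Φ (z + fun t ↦ -u (I t)) :=
    congr_arg _ <| alg.actionLaw_singleton_congr fun t ↦ noisyLoss_add s u z t (I t)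
  have hexp (z : Fin T → ℝ) :
      ∑ t, (2 * -u (I t) * z t - (-u (I t)) ^ 2) / (2 * (v : ℝ)) = -logRatio v u (z, I) := by
    rw [logRatio, ← Finset.sum_neg_distrib]
    exact Finset.sum_congr rfl fun t _ ↦ by ring
  simp only [hshift, Pi.mul_apply, mul_assoc]
  rw [lintegral_pi_gaussianReal_zero_add (fun _ ↦ hv) _ hΦ]
  simp only [hexp, Φ]

/-- The expected number of plays of arm `i` in `T` rounds with advantages `s`. -/
noncomputable def expectedPlays (v : ℝ≥0) (T : ℕ) (s : Fin K → ℝ) (i : Fin K) : ℝ :=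
  ∑ t : Fin T, (alg.noisyGame v T s).real {p | p.2 t = i}

theorem expectedPlays_nonneg (s : Fin K → ℝ) (i : Fin K) : 0 ≤ alg.expectedPlays v T s i :=
  Finset.sum_nonneg fun _ _ ↦ measureReal_nonneg

theorem sum_integral_comp_action (s : Fin K → ℝ) (f : Fin K → ℝ) :
    ∑ t, ∫ p, f (p.2 t) ∂alg.noisyGame v T s = ∑ i, f i * alg.expectedPlays v T s i := by
  have hround (t : Fin T) : ∫ p, f (p.2 t) ∂alg.noisyGame v T s =
      ∑ i, f i * (alg.noisyGame v T s).real {p | p.2 t = i} := by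
    rw [← integral_map (φ := fun p : (Fin T → ℝ) × (Fin T → Fin K) ↦ p.2 t) (by fun_prop)
      (measurable_of_finite f).aestronglyMeasurable, integral_fintype .of_finite]
    refine Finset.sum_congr rfl fun i _ ↦ ?_
    rw [map_measureReal_apply (by fun_prop) (measurableSet_singleton i), smul_eq_mul, mul_comm]
    rfl
  simp only [hround, expectedPlays, Finset.mul_sum]
  exact Finset.sum_comm

theorem sum_expectedPlays (s : Fin K → ℝ) : ∑ i, alg.expectedPlays v T s i = T := by
  simpa using (alg.sum_integral_comp_action (v := v) (T := T) s 1).symm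

theorem exists_ne_expectedPlays_le (hK : 2 ≤ K) (s : Fin K → ℝ) (a : Fin K) :
    ∃ i ≠ a, ((K : ℝ) - 1) * alg.expectedPlays v T s i ≤ T := by
  have hcard : (#(Finset.univ.erase a) : ℝ) = K - 1 := by
    rw [Finset.card_erase_of_mem (Finset.mem_univ a), Finset.card_univ, Fintype.card_fin,
      Nat.cast_pred (by lia)]
  have hsum : ∑ i ∈ Finset.univ.erase a, alg.expectedPlays v T s i ≤ T :=
    (Finset.sum_le_univ_sum_of_nonneg (alg.expectedPlays_nonneg s)).trans_eq
      (alg.sum_expectedPlays s)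
  have hK₁ : (1 : ℝ) < K := by exact_mod_cast hK
  obtain ⟨i, hi, hle⟩ := Finset.exists_le_of_sum_le (s := Finset.univ.erase a)
    (f := alg.expectedPlays v T s) (g := fun _ ↦ (T : ℝ) / (K - 1))
    (Finset.card_pos.1 <| by rw [← Nat.cast_pos (α := ℝ), hcard]; linarith)
    (by rwa [Finset.sum_const, nsmul_eq_mul, hcard, mul_div_cancel₀ _ (by linarith)])
  exact ⟨i, Finset.ne_of_mem_erase hi, (le_div_iff₀' (by linarith)).1 hle⟩

theorem integrable_comp_action (s : Fin K → ℝ) (f : Fin K → ℝ) (t : Fin T) :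
    Integrable (fun p ↦ f (p.2 t)) (alg.noisyGame v T s) :=
  (Integrable.of_finite (f := fun I : Fin T → Fin K ↦ f (I t))).comp_measurable measurable_snd

theorem integrable_noise (s : Fin K → ℝ) (t : Fin T) :
    Integrable (fun p ↦ p.1 t) (alg.noisyGame v T s) := by
  refine Integrable.comp_measurable (g := fun z : Fin T → ℝ ↦ z t) ?_ measurable_fst
  rw [← Measure.fst, noisyGame, Measure.fst_compProd]
  exact integrable_comp_eval (f := id) ((memLp_id_gaussianReal 1).integrable le_rfl)

theorem integrable_noise_mul_action (s : Fin K → ℝ) (f : Fin K → ℝ) (t : Fin T) :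
    Integrable (fun p ↦ p.1 t * f (p.2 t)) (alg.noisyGame v T s) := by
  obtain ⟨c, hc⟩ := (finite_range f).isBounded.exists_norm_le
  exact (alg.integrable_noise s t).mul_bdd (c := c) (by fun_prop) <|
    .of_forall fun p ↦ hc _ (mem_range_self _)

theorem dependsOn_integral_actionLaw_noisyLoss (s : Fin K → ℝ) (f : Fin K → ℝ) (t : Fin T) :
    DependsOn (fun z ↦ ∫ I, f (I t) ∂alg.actionLaw (noisyLoss s z)) (Iio t) := by
  intro z z' h
  have hlosses : ∀ r ∈ Iio t, noisyLoss s z r = noisyLoss s z' r := fun r hr ↦ by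
    funext j
    rw [noisyLoss, noisyLoss, h r hr]
  have hmap (ℓ : Fin T → Fin K → ℝ) :
      ∫ I, f (I t) ∂alg.actionLaw ℓ = ∫ i, f i ∂(alg.actionLaw ℓ).map fun I ↦ I t :=
    (integral_map (measurable_of_finite _).aemeasurable
      (measurable_of_finite f).aestronglyMeasurable).symm
  simp only [hmap]
  exact congr_arg (∫ i, f i ∂·) (alg.dependsOn_map_eval_actionLaw t hlosses)

theorem integral_noise_mul_action (s : Fin K → ℝ) (f : Fin K → ℝ) (t : Fin T) :
    ∫ p, p.1 t * f (p.2 t) ∂alg.noisyGame v T s = 0 := by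
  let g (z : Fin T → ℝ) : ℝ := ∫ I, f (I t) ∂alg.actionLaw (noisyLoss s z)
  have hg : Measurable g :=
    (StronglyMeasurable.integral_kernel (κ := alg.actionKernel.comap _ (measurable_noisyLoss s))
      (measurable_of_finite fun I : Fin T → Fin K ↦ f (I t)).stronglyMeasurable).measurable
  have hgt : DependsOn g {t}ᶜ :=
    (alg.dependsOn_integral_actionLaw_noisyLoss s f t).mono fun r hr ↦ ne_of_lt hr
  calc ∫ p, p.1 t * f (p.2 t) ∂alg.noisyGame v T s
      = ∫ z, ∫ I, z t * f (I t) ∂alg.actionLaw (noisyLoss s z) ∂gaussianNoise v T :=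
        Measure.integral_compProd (alg.integrable_noise_mul_action s f t)
    _ = ∫ z, z t * g z ∂gaussianNoise v T := by simp only [integral_const_mul, g]
    _ = 0 := integral_eval_mul_eq_zero_of_dependsOn (by simp) hg hgt

theorem integrable_logRatio (s u : Fin K → ℝ) :
    Integrable (logRatio v u) (alg.noisyGame v T s) :=
  integrable_finsetSum _ fun t _ ↦ (((alg.integrable_noise_mul_action s u t).const_mul 2).add
    (alg.integrable_comp_action s (fun i ↦ u i ^ 2) t)).div_const _

theorem integral_logRatio (s u : Fin K → ℝ) :
    ∫ p, logRatio v u p ∂alg.noisyGame v T s =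
      ∑ i, u i ^ 2 / (2 * v) * alg.expectedPlays v T s i := by
  have hnoise (t : Fin T) := (alg.integrable_noise_mul_action (v := v) s u t).const_mul 2
  have hplay (t : Fin T) := alg.integrable_comp_action (v := v) s (fun i ↦ u i ^ 2) t
  calc ∫ p, logRatio v u p ∂alg.noisyGame v T s
      = ∑ t, ∫ p, (2 * (p.1 t * u (p.2 t)) + u (p.2 t) ^ 2) / (2 * v) ∂alg.noisyGame v T s :=
        integral_finsetSum _ fun t _ ↦ ((hnoise t).add (hplay t)).div_const _
    _ = ∑ t, ∫ p, u (p.2 t) ^ 2 / (2 * v) ∂alg.noisyGame v T s := by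
        refine Finset.sum_congr rfl fun t _ ↦ ?_
        rw [integral_div, integral_add (hnoise t) (hplay t), integral_const_mul,
          integral_noise_mul_action, mul_zero, zero_add, integral_div]
    _ = ∑ i, u i ^ 2 / (2 * v) * alg.expectedPlays v T s i :=
        alg.sum_integral_comp_action s fun i ↦ u i ^ 2 / (2 * v)

theorem klDiv_noisyGame (hv : v ≠ 0) (s u : Fin K → ℝ) :
    klDiv (alg.noisyGame v T s) ((alg.noisyGame v T (s + u)).map (recentre u)) =
      ENNReal.ofReal (∑ i, u i ^ 2 / (2 * v) * alg.expectedPlays v T s i) := by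
  have hprob : IsProbabilityMeasure ((alg.noisyGame v T (s + u)).map (recentre u)) :=
    Measure.isProbabilityMeasure_map (measurable_recentre u).aemeasurable
  rw [alg.map_recentre_noisyGame_add hv] at hprob ⊢
  rw [klDiv_withDensity_exp_neg (measurable_logRatio u) (alg.integrable_logRatio s u),
    alg.integral_logRatio]

theorem exp_neg_sum_mul_expectedPlays_le (hv : v ≠ 0) (s u : Fin K → ℝ) (A : Set (Fin T → Fin K)) :
    Real.exp (-∑ i, u i ^ 2 / (2 * v) * alg.expectedPlays v T s i) / 2 ≤
      (alg.noisyGame v T s).real (Prod.snd ⁻¹' A) +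
        (alg.noisyGame v T (s + u)).real (Prod.snd ⁻¹' Aᶜ) := by
  have hprob : IsProbabilityMeasure ((alg.noisyGame v T (s + u)).map (recentre u)) :=
    Measure.isProbabilityMeasure_map (measurable_recentre u).aemeasurable
  have hkl := alg.klDiv_noisyGame (T := T) hv s u
  have hsum : 0 ≤ ∑ i, u i ^ 2 / (2 * v) * alg.expectedPlays v T s i :=
    Finset.sum_nonneg fun i _ ↦ mul_nonneg (by positivity) (alg.expectedPlays_nonneg s i)
  have hA := A.toFinite.measurableSet
  have h := exp_neg_toReal_klDiv_le (hkl ▸ ENNReal.ofReal_ne_top) (measurable_snd hA)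
  rw [hkl, ENNReal.toReal_ofReal hsum, map_measureReal_apply (measurable_recentre u)
    (measurable_snd hA).compl] at h
  exact h

theorem exp_neg_mul_expectedPlays_le (hv : v ≠ 0) (s : Fin K → ℝ) (i : Fin K) (d : ℝ)
    (A : Set (Fin T → Fin K)) :
    Real.exp (-(d ^ 2 / (2 * v) * alg.expectedPlays v T s i)) / 2 ≤
      (alg.noisyGame v T s).real (Prod.snd ⁻¹' A) +
        (alg.noisyGame v T (s + Pi.single i d)).real (Prod.snd ⁻¹' Aᶜ) := by
  convert alg.exp_neg_sum_mul_expectedPlays_le hv s (Pi.single i d) A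
  rw [Fintype.sum_eq_single i fun j hj ↦ by simp [hj], Pi.single_eq_same]

end BanditAlgorithm

theorem hasGap_single {K : ℕ} (a : Fin K) {Δ : ℝ} (hΔ : 0 ≤ Δ) :
    HasGap (Pi.single a Δ) a Δ (2 * Δ) where
  mem_Icc j := by
    obtain rfl | hj := eq_or_ne j a
    · rw [Pi.single_eq_same]
      constructor <;> linarith
    · rw [Pi.single_eq_of_ne hj]
      constructor <;> linarith
  add_le j hj := by rw [Pi.single_eq_of_ne hj, Pi.single_eq_same, zero_add]

theorem hasGap_single_add_single {K : ℕ} {a i : Fin K} (hia : i ≠ a) {Δ : ℝ} (hΔ : 0 ≤ Δ) :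
    HasGap (Pi.single a Δ + Pi.single i (2 * Δ)) i Δ (2 * Δ) where
  mem_Icc j := by
    obtain rfl | hj := eq_or_ne j i
    · simp [hia, hΔ]
    · rw [Pi.add_apply, Pi.single_eq_of_ne hj, add_zero]
      exact (hasGap_single a hΔ).mem_Icc j
  add_le j hj := by
    have hle := (hasGap_single a hΔ).le hΔ j
    rw [Pi.single_eq_same] at hle
    rw [Pi.add_apply, Pi.add_apply, Pi.single_eq_of_ne hj, Pi.single_eq_of_ne hia,
      Pi.single_eq_same]
    linarith

/-- The action sequences that play an arm other than `b` in at least half of the rounds. -/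
def mostlyAvoiding {K T : ℕ} (b : Fin K) : Set (Fin T → Fin K) :=
  {I | (T : ℝ) / 2 ≤ #{t | I t ≠ b}}

theorem compl_mostlyAvoiding_subset {K T : ℕ} {a b : Fin K} (hab : a ≠ b) :
    (mostlyAvoiding (T := T) a)ᶜ ⊆ mostlyAvoiding b := by
  intro I hI
  have hfew : (#{t | I t ≠ a} : ℝ) < T / 2 := not_le.1 hI
  have hcover : T ≤ #{t | I t ≠ a} + #{t | I t ≠ b} := by
    refine (Finset.card_fin T).symm.trans_le <|
      (Finset.card_le_card fun t _ ↦ ?_).trans (Finset.card_union_le _ _)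
    by_cases h : I t = a <;> simp_all
  have hcover' : (T : ℝ) ≤ #{t | I t ≠ a} + #{t | I t ≠ b} := by exact_mod_cast hcover
  exact (by linarith : (T : ℝ) / 2 ≤ #{t | I t ≠ b})

theorem measureReal_gaussianNoise_lt_card_le {v : ℝ≥0} {c : ℝ}
    (htail : (gaussianReal 0 v).real {x | c < |x|} ≤ 1 / 8) (T : ℕ) :
    (gaussianNoise v T).real {z | (T : ℝ) / 4 < #{t | c < |z t|}} ≤ Real.exp (-T / 32) := by
  classical
  let B : Set ℝ := {x | c < |x|}
  have hB : MeasurableSet B := measurableSet_lt measurable_const measurable_id.abs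
  have hsub : {z : Fin T → ℝ | (T : ℝ) / 4 < #{t | c < |z t|}} ⊆
      {z | T * ((gaussianReal 0 v).real B + 1 / 8) ≤ #{t | z t ∈ B}} := by
    intro z hz
    have hle : T * ((gaussianReal 0 v).real B + 1 / 8) ≤ (T : ℝ) / 4 :=
      (mul_le_mul_of_nonneg_left (by linarith : _ ≤ (1 : ℝ) / 4) T.cast_nonneg).trans_eq (by ring)
    have hcard : (#{t | z t ∈ B} : ℝ) = #{t | c < |z t|} := by congr
    exact hle.trans (hz.le.trans_eq hcard.symm)
  have hhoeffding := measureReal_pi_le_card_filter_mem_le (ι := Fin T) (gaussianReal 0 v) hB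
    (ε := 1 / 8) (by norm_num)
  rw [Fintype.card_fin] at hhoeffding
  exact (measureReal_mono hsub).trans (hhoeffding.trans_eq <| by ring_nf)

namespace BanditAlgorithm

variable {K T : ℕ} {Ω : Type*} [MeasurableSpace Ω] (alg : BanditAlgorithm K Ω) {v : ℝ≥0}
  {δ Δ d : ℝ}

theorem exists_noise_le_regret {s : Fin K → ℝ} {b : Fin K} (hs : HasGap s b Δ d) (hΔ : 0 ≤ Δ)
    (hδ : 0 < δ) (htail : (gaussianReal 0 v).real {x | 1 / 2 - d < |x|} ≤ 1 / 8)
    (hT : Real.exp (-T / 32) ≤ δ / 2)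
    (hplays : δ ≤ (alg.noisyGame v T s).real (Prod.snd ⁻¹' mostlyAvoiding b)) :
    ∃ z : Fin T → ℝ, ENNReal.ofReal (δ / 2) ≤
      alg.actionLaw (noisyLoss s z) {I | Δ * (T / 4) ≤ regret (noisyLoss s z) I} := by
  let clipped : Set (Fin T → ℝ) := {z | (T : ℝ) / 4 < #{t | 1 / 2 - d < |z t|}}
  have hclipped : gaussianNoise v T clipped ≤ ENNReal.ofReal (δ / 2) := by
    rw [← ofReal_measureReal]
    exact ENNReal.ofReal_le_ofReal ((measureReal_gaussianNoise_lt_card_le htail T).trans hT)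
  have hmean : ENNReal.ofReal (δ / 2) + gaussianNoise v T clipped ≤
      ∫⁻ z, alg.actionLaw (noisyLoss s z) (mostlyAvoiding b) ∂gaussianNoise v T := calc
    _ ≤ ENNReal.ofReal (δ / 2) + ENNReal.ofReal (δ / 2) := by gcongr
    _ = ENNReal.ofReal δ := by rw [← ENNReal.ofReal_add (by positivity) (by positivity), add_halves]
    _ ≤ alg.noisyGame v T s (Prod.snd ⁻¹' mostlyAvoiding b) := by
      rw [← ofReal_measureReal]
      exact ENNReal.ofReal_le_ofReal hplays
    _ = _ := alg.noisyGame_preimage_snd s _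
  obtain ⟨z, hz, hle⟩ := exists_notMem_le_of_add_le_lintegral (fun z ↦ prob_le_one)
    (by simpa using hδ) hmean
  refine ⟨z, hle.trans <| measure_mono fun I hI ↦ le_trans ?_ (hs.le_regret hΔ I)⟩
  have hunclipped : (#{t | 1 / 2 - d < |z t|} : ℝ) ≤ T / 4 := not_lt.1 hz
  have hsuboptimal : (T : ℝ) / 2 ≤ #{t | I t ≠ b} := hI
  gcongr
  linarith

theorem exists_ne_le_noisyGame_mostlyAvoiding (hK : 2 ≤ K) (hv : v ≠ 0) (a : Fin K)
    (s : Fin K → ℝ) (hd : d ^ 2 / (2 * v) * T ≤ (K - 1) * Real.log (1 / (4 * δ))) (hδ : 0 < δ) :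
    ∃ i ≠ a, δ ≤ (alg.noisyGame v T s).real (Prod.snd ⁻¹' mostlyAvoiding a) ∨
      δ ≤ (alg.noisyGame v T (s + Pi.single i d)).real (Prod.snd ⁻¹' mostlyAvoiding i) := by
  obtain ⟨i, hia, hplays⟩ := alg.exists_ne_expectedPlays_le (v := v) (T := T) hK s a
  refine ⟨i, hia, ?_⟩
  have hK₁ : (0 : ℝ) < K - 1 := sub_pos.2 (by exact_mod_cast hK)
  have hinfo : d ^ 2 / (2 * v) * alg.expectedPlays v T s i ≤ Real.log (1 / (4 * δ)) := by
    refine le_of_mul_le_mul_left (le_trans ?_ hd) hK₁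
    rw [mul_left_comm]
    gcongr
  have htest : 2 * δ ≤ (alg.noisyGame v T s).real (Prod.snd ⁻¹' mostlyAvoiding a) +
      (alg.noisyGame v T (s + Pi.single i d)).real (Prod.snd ⁻¹' mostlyAvoiding i) := calc
    2 * δ = Real.exp (-Real.log (1 / (4 * δ))) / 2 := by
      rw [Real.exp_neg, Real.exp_log (by positivity), one_div, inv_inv]
      ring
    _ ≤ Real.exp (-(d ^ 2 / (2 * v) * alg.expectedPlays v T s i)) / 2 := by gcongr
    _ ≤ _ := alg.exp_neg_mul_expectedPlays_le hv s i d (mostlyAvoiding a)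
    _ ≤ _ := by
      gcongr
      · exact measure_ne_top _ _
      · exact compl_mostlyAvoiding_subset hia.symm
  by_contra! h
  linarith

theorem exists_hasGap_noise_le_regret (hK : 2 ≤ K) (hv : v ≠ 0) (hδ : 0 < δ) (hΔ : 0 ≤ Δ)
    (hd : (2 * Δ) ^ 2 / (2 * v) * T ≤ (K - 1) * Real.log (1 / (4 * δ)))
    (htail : (gaussianReal 0 v).real {x | 1 / 2 - 2 * Δ < |x|} ≤ 1 / 8)
    (hT : Real.exp (-T / 32) ≤ δ / 2) :
    ∃ (s : Fin K → ℝ) (b : Fin K) (z : Fin T → ℝ), HasGap s b Δ (2 * Δ) ∧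
      ENNReal.ofReal (δ / 2) ≤
        alg.actionLaw (noisyLoss s z) {I | Δ * (T / 4) ≤ regret (noisyLoss s z) I} := by
  let a : Fin K := ⟨0, by lia⟩
  obtain ⟨i, hia, hplays | hplays⟩ :=
    alg.exists_ne_le_noisyGame_mostlyAvoiding hK hv a (Pi.single a Δ) hd hδ
  · exact ⟨_, a, (alg.exists_noise_le_regret (hasGap_single a hΔ) hΔ hδ htail hT hplays).imp
      fun z hz ↦ ⟨hasGap_single a hΔ, hz⟩⟩
  · have hgap := hasGap_single_add_single hia hΔ
    exact ⟨_, i, (alg.exists_noise_le_regret hgap hΔ hδ htail hT hplays).imp fun z hz ↦ ⟨hgap, hz⟩⟩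

end BanditAlgorithm

/-- The variance of the noise: small enough for few rounds to be clipped, and large enough for the
change of measure to lose only a constant factor. -/
noncomputable def noiseVariance : ℝ≥0 := (1 / (32 * Real.log 2)).toNNReal

/-- The gap between the best arm and the others: raising the advantage of an arm that is played
`T / (K - 1)` times in expectation by twice this gap costs a divergence of `log (1 / (4 * δ))`. -/
noncomputable def hardGap (K T : ℕ) (δ : ℝ) : ℝ :=
  √(((K : ℝ) - 1) * Real.log (1 / (4 * δ)) / T) / (8 * √(Real.log 2))

section HardGap

variable {K T : ℕ} {δ : ℝ}

theorem coe_noiseVariance : (noiseVariance : ℝ) = 1 / (32 * Real.log 2) :=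
  Real.coe_toNNReal _ (by positivity)

theorem noiseVariance_ne_zero : noiseVariance ≠ 0 := by
  rw [← NNReal.coe_ne_zero, coe_noiseVariance]
  positivity

theorem hardGap_nonneg : 0 ≤ hardGap K T δ := by
  unfold hardGap
  positivity

theorem two_mul_hardGap :
    2 * hardGap K T δ =
      √(((K : ℝ) - 1) * Real.log (1 / (4 * δ)) / T) / (4 * √(Real.log 2)) := by
  rw [hardGap]
  ring

theorem log_one_div_four_mul_nonneg (hδ₀ : 0 < δ) (hδ₁ : δ < 1 / 4) :
    0 ≤ Real.log (1 / (4 * δ)) :=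
  Real.log_nonneg <| (one_le_div (by positivity)).2 (by linarith)

theorem sq_hardGap (hK : 1 ≤ K) (hδ₀ : 0 < δ) (hδ₁ : δ < 1 / 4) :
    64 * Real.log 2 * hardGap K T δ ^ 2 = (K - 1) * Real.log (1 / (4 * δ)) / T := by
  have hL := log_one_div_four_mul_nonneg hδ₀ hδ₁
  have hK₁ : (0 : ℝ) ≤ K - 1 := sub_nonneg.2 (by exact_mod_cast hK)
  rw [hardGap, div_pow, mul_pow, Real.sq_sqrt (by positivity), Real.sq_sqrt (by positivity)]
  field_simp
  ring

theorem sq_two_mul_hardGap_div_mul (hK : 1 ≤ K) (hT : 0 < T) (hδ₀ : 0 < δ) (hδ₁ : δ < 1 / 4) :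
    (2 * hardGap K T δ) ^ 2 / (2 * noiseVariance) * T = (K - 1) * Real.log (1 / (4 * δ)) := by
  have hT' : (T : ℝ) ≠ 0 := by exact_mod_cast hT.ne'
  rw [← div_mul_cancel₀ ((K - 1) * Real.log (1 / (4 * δ))) hT', ← sq_hardGap hK hδ₀ hδ₁,
    coe_noiseVariance]
  field_simp
  ring

theorem sqrt_le_hardGap_mul (hT : 0 < T) :
    1 / 27 * √(((K : ℝ) - 1) * T * Real.log (1 / (4 * δ))) ≤ hardGap K T δ * (T / 4) := by
  have hT' : (0 : ℝ) < T := by exact_mod_cast hT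
  have hlog : √(Real.log 2) ≤ 27 / 32 :=
    (Real.sqrt_le_left (by norm_num)).2 (by linarith [Real.log_two_lt_d9])
  have hsqrt : √(((K : ℝ) - 1) * T * Real.log (1 / (4 * δ))) =
      √(((K : ℝ) - 1) * Real.log (1 / (4 * δ)) / T) * T := by
    rw [← Real.sqrt_mul_self hT'.le, ← Real.sqrt_mul' _ (by positivity), Real.sqrt_mul_self hT'.le]
    congr 1
    field_simp
  calc 1 / 27 * √(((K : ℝ) - 1) * T * Real.log (1 / (4 * δ)))
      = 1 / (32 * (27 / 32)) * (√(((K : ℝ) - 1) * Real.log (1 / (4 * δ)) / T) * T) := by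
        rw [hsqrt]
        norm_num
    _ ≤ 1 / (32 * √(Real.log 2)) * (√(((K : ℝ) - 1) * Real.log (1 / (4 * δ)) / T) * T) := by
        gcongr
    _ = hardGap K T δ * (T / 4) := by
        rw [hardGap]
        ring

theorem gaussianReal_noiseVariance_tail_le {Δ : ℝ} (hΔ : Δ ≤ 3 / 100) :
    (gaussianReal 0 noiseVariance).real {x | 1 / 2 - 2 * Δ < |x|} ≤ 1 / 8 := by
  refine (gaussianReal_zero_real_setOf_lt_abs_le (by linarith) noiseVariance_ne_zero).trans ?_
  calc Real.exp (-(1 / 2 - 2 * Δ) ^ 2 / (2 * noiseVariance))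
      = Real.exp (-(16 * (1 / 2 - 2 * Δ) ^ 2 * Real.log 2)) := by
        rw [coe_noiseVariance]
        congr 1
        field_simp
        ring
    _ ≤ Real.exp (-(3 * Real.log 2)) := by
        gcongr
        nlinarith
    _ = 1 / 8 := by
        rw [Real.exp_neg, mul_comm, Real.exp_mul, Real.exp_log two_pos]
        norm_num

theorem hardGap_le (hK : 1 ≤ K) (hδ₀ : 0 < δ) (hδ₁ : δ < 1 / 4)
    (hT : 32 * ((K : ℝ) - 1) * Real.log (2 / δ) ≤ T) : hardGap K T δ ≤ 3 / 100 := by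
  have hK₁ : (0 : ℝ) ≤ K - 1 := sub_nonneg.2 (by exact_mod_cast hK)
  have hlog : Real.log (1 / (4 * δ)) ≤ Real.log (2 / δ) := by
    refine Real.log_le_log (by positivity) ((div_le_div_iff₀ (by positivity) hδ₀).2 ?_)
    linarith
  have hratio : ((K : ℝ) - 1) * Real.log (1 / (4 * δ)) / T ≤ 1 / 32 := by
    refine div_le_of_le_mul₀ T.cast_nonneg (by norm_num) ?_
    nlinarith
  rw [← sq_hardGap hK hδ₀ hδ₁] at hratio
  refine le_of_sq_le_sq ?_ (by norm_num)
  nlinarith [Real.log_two_gt_d9, sq_nonneg (hardGap K T δ)]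

theorem exp_neg_div_le (hK : 2 ≤ K) (hδ₀ : 0 < δ) (hδ₁ : δ < 1 / 4)
    (hT : 32 * ((K : ℝ) - 1) * Real.log (2 / δ) ≤ T) : Real.exp (-T / 32) ≤ δ / 2 := by
  have hK₁ : (1 : ℝ) ≤ K - 1 := by
    have : (2 : ℝ) ≤ K := by exact_mod_cast hK
    linarith
  have hlog : 0 ≤ Real.log (2 / δ) := Real.log_nonneg <| (one_le_div hδ₀).2 (by linarith)
  calc Real.exp (-T / 32) ≤ Real.exp (-Real.log (2 / δ)) := by
        gcongr
        nlinarith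
    _ = δ / 2 := by rw [Real.exp_neg, Real.exp_log (by positivity), inv_div]

end HardGap

theorem theorem1 (K T : ℕ) (hK : 2 ≤ K) (δ : ℝ) (hδ₀ : 0 < δ) (hδ₁ : δ < 1 / 4)
    (hT : 32 * ((K : ℝ) - 1) * Real.log (2 / δ) ≤ (T : ℝ))
    {Ω : Type*} [MeasurableSpace Ω] (alg : BanditAlgorithm K Ω) :
    ∃ ℓ : Fin T → Fin K → ℝ,
      (∀ t i, ℓ t i ∈ Set.Icc (0 : ℝ) 1) ∧
      ENNReal.ofReal (δ / 2) ≤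
        alg.actionLaw ℓ {I | 1 / 27 * √(((K : ℝ) - 1) * T * Real.log (1 / (4 * δ))) ≤ regret ℓ I} ∧
      (∃ i, ∀ t j, ℓ t i ≤ ℓ t j) ∧
      (∀ t j k, ℓ t j - ℓ t k ≤
        √(((K : ℝ) - 1) * Real.log (1 / (4 * δ)) / T) / (4 * √(Real.log 2))) := by
  have hT₀ : 0 < T := by
    have hK₁ : (0 : ℝ) < K - 1 := sub_pos.2 (by exact_mod_cast hK)
    have hlog : 0 < Real.log (2 / δ) := Real.log_pos ((one_lt_div hδ₀).2 (by linarith))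
    exact Nat.cast_pos.1 ((mul_pos (mul_pos (by norm_num) hK₁) hlog).trans_le hT)
  obtain ⟨s, b, z, hgap, hregret⟩ := alg.exists_hasGap_noise_le_regret hK noiseVariance_ne_zero hδ₀
    hardGap_nonneg (sq_two_mul_hardGap_div_mul (by lia) hT₀ hδ₀ hδ₁).le
    (gaussianReal_noiseVariance_tail_le (hardGap_le (by lia) hδ₀ hδ₁ hT))
    (exp_neg_div_le hK hδ₀ hδ₁ hT)
  refine ⟨noisyLoss s z, noisyLoss_mem_Icc, ?_, ⟨b, fun t j ↦ ?_⟩, fun t j k ↦ ?_⟩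
  · exact hregret.trans <| measure_mono fun I hI ↦ (sqrt_le_hardGap_mul hT₀).trans hI
  · exact noisyLoss_le_noisyLoss (hgap.le hardGap_nonneg j) t
  · exact (noisyLoss_sub_le hgap.mem_Icc t j k).trans_eq two_mul_hardGap
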